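/- Let $p$ be a prime and let $\varepsilon:\operatorname{Spec} B\to\operatorname{Spec} A$ be an étale morphism between affine $\mathbb F_p$-schemes. For $x\in\operatorname{Spec} A$ let $n(x)$ be the number of geometric points of the fiber of $\varepsilon$ at $x$, i.e. the number of lifts to $\operatorname{Spec} B$ of the geometric point $\operatorname{Spec}\overline{\kappa(x)}\to\operatorname{Spec} A$, where $\overline{\kappa(x)}$ is an algebraic closure of the residue field of $x$. By the functorial Artin–Schreier stratification associated to $\varepsilon$ we mean the following data: the strictly decreasing finite sequence $\mu_1>\mu_2>\cdots>\mu_v$ of natural numbers whose terms are exactly the values of $n$, together with reduced locally closed subschemes $U_1,\ldots,U_v$ of $\operatorname{Spec} A$ defined inductively as follows: for each $l\in\{1,\ldots,v\}$ the subset $Z_l=(\operatorname{Spec} A)\setminus\bigcup_{q=1}^{l-1}U_q$ is closed and, endowing it with its reduced scheme structure, $U_l$ is the largest open subscheme of $Z_l$ such that $(\operatorname{Spec} B)\times_{\operatorname{Spec} A}U_l\to U_l$ is an étale cover (a finite étale morphism, not necessarily surjective) all of whose fibers have exactly $\mu_l$ geometric points. Then this stratification exists; for each $l\in\{1,\ldots,v\}$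 the stratum $U_l$ is the set of all $x\in\operatorname{Spec} A$ with $n(x)=\mu_l$; and each stratum $U_l$ is pure in $\operatorname{Spec} A$, i.e. $U_l$ is a reduced locally closed subscheme of $\operatorname{Spec} A$ for which the inclusion $U_l\to\operatorname{Spec} A$ is an affine morphism. -/

import Mathlib

open CategoryTheory CategoryTheory.Limits AlgebraicGeometry TopologicalSpace

universe u

noncomputable section

namespace ASStrat

/-- The geometric point of `S` supported at `s`, with values in an algebraic closure of the
residue field `κ(s)`. -/
def geomPoint (S : Scheme.{u}) (s : S) :
    Spec (CommRingCat.of (AlgebraicClosure (S.residueField s))) ⟶ S :=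
  Spec.map (CommRingCat.ofHom
    (algebraMap (S.residueField s) (AlgebraicClosure (S.residueField s)))) ≫
    S.fromSpecResidueField s

/-- The number (possibly `⊤`) of geometric points of the fibre of `f : X ⟶ S` at `s`, i.e. the
number of lifts to `X` of the geometric point of `S` supported at `s`. -/
def geomFiberCard {X S : Scheme.{u}} (f : X ⟶ S) (s : S) : ℕ∞ :=
  ENat.card {t : Spec (CommRingCat.of (AlgebraicClosure (S.residueField s))) ⟶ X //
    t ≫ f = geomPoint S s}

/-- The closed subset `Z` of `S` with its reduced induced scheme structure. -/
abbrev reducedClosed {S : Scheme.{u}} (Z : Closeds S) : Scheme.{u} :=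
  (Scheme.IdealSheafData.vanishingIdeal Z).subscheme

/-- The closed immersion of the reduced closed subscheme `Z` into `S`. -/
abbrev reducedClosedι {S : Scheme.{u}} (Z : Closeds S) : reducedClosed Z ⟶ S :=
  (Scheme.IdealSheafData.vanishingIdeal Z).subschemeι

/-- The inclusion into `S` of an open subscheme `W` of the reduced closed subscheme `Z` of `S`. -/
abbrev stratumι {S : Scheme.{u}} {Z : Closeds S} (W : (reducedClosed Z).Opens) :
    W.toScheme ⟶ S :=
  W.ι ≫ reducedClosedι Z

/-- An étale cover all of whose fibres have exactly `m` geometric points. An étale cover is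
a finite étale morphism; it is not required to be surjective, so `m = 0` is allowed. -/
structure IsEtaleCoverOfCard {X S : Scheme.{u}} (g : X ⟶ S) (m : ℕ) : Prop where
  isFinite : IsFinite g
  etale : Etale g
  card_eq : ∀ s : S, geomFiberCard g s = m

/-- The functorial Artin–Schreier stratification associated to `f : X ⟶ S`. -/
structure FunctorialStratification {X S : Scheme.{u}} (f : X ⟶ S) where
  /-- The number of strata. -/
  v : ℕ
  /-- The numbers of geometric points of the fibres of `f`, in decreasing order. -/
  μ : Fin v → ℕ
  strictAnti : StrictAnti μ
  range_eq : Set.range (fun l => (μ l : ℕ∞)) = Set.range (geomFiberCard f)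
  /-- What remains of `S` when the strata before the `l`-th one are removed. -/
  Z : Fin v → Closeds S
  /-- The `l`-th stratum, an open subscheme of the reduced scheme `Z l`. -/
  U : (l : Fin v) → (reducedClosed (Z l)).Opens
  Z_eq : ∀ l, (Z l : Set S) = (⋃ q : {q : Fin v // q < l}, Set.range (stratumι (U q.1)))ᶜ
  isGreatest : ∀ l, IsGreatest
    {W : (reducedClosed (Z l)).Opens |
      IsEtaleCoverOfCard (pullback.snd f (stratumι W)) (μ l)} (U l)

/-- A subscheme of `S`, given by its inclusion `i`, is pure in `S` if it is a reduced locally closed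
subscheme which is an affine `S`-scheme. -/
def IsPure {Z S : Scheme.{u}} (i : Z ⟶ S) : Prop :=
  AlgebraicGeometry.IsReduced Z ∧ IsImmersion i ∧ IsAffineHom i

end ASStrat

end

/-! By induction on `k`, splitting off the diagonal of `B ⊗[A] B` gives an étale algebra `C`
parametrizing `k`-tuples of distinct points in the fibres of `B` (`exists_etale_configuration`). The
image of `Spec C` is the locus of degree at least `k`, so that locus is open. Degrees are bounded,
by Zariski's main theorem (`exists_fiberDegree_le`).

If `k = m` bounds all degrees, `B` splits over `C`, and `C` is generated by the coordinates of the
tuple. Each coordinate is killed by a characteristic polynomial whose coefficients descend to the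
image `U` of `Spec C`, so `C` is integral over `Γ(U)` (`isIntegral_equalizer`,
`isIntegral_appTop_of_isIntegral_equalizer`). Hence `Spec C → Spec Γ(U)` is surjective; it factors
through the open immersion `U → Spec Γ(U)`, so the quasi-affine `U` is affine. Finiteness over `U`
descends from `Spec C`.

Applied to the reduced closed subschemes `Z_l`, this makes each stratum the locus of degree `μ_l`,
affine and hence pure. -/

noncomputable section

namespace ASStrat

open TensorProduct

/-! ### Fibre degrees of algebras and their behaviour under base change -/

section FiberDegree

/-- The degree of the fibre of `Spec B → Spec A` at `p`. -/
def fiberDegree (A B : Type*) [CommRing A] [CommRing B] [Algebra A B]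
    (p : PrimeSpectrum A) : ℕ :=
  Module.finrank p.asIdeal.ResidueField (p.asIdeal.Fiber B)

variable {A B : Type*} [CommRing A] [CommRing B] [Algebra A B]

lemma finrank_tensorProduct_eq_fiberDegree {K : Type*} [Field K] [Algebra A K]
    (p : PrimeSpectrum A) (hp : p.asIdeal = RingHom.ker (algebraMap A K)) :
    Module.finrank K (K ⊗[A] B) = fiberDegree A B p := by
  let f : p.asIdeal.ResidueField →ₐ[A] K :=
    Ideal.ResidueField.liftₐ p.asIdeal (Algebra.ofId A K) hp.le fun x hx ↦ by
      refine (isUnit_iff_ne_zero.mpr fun h ↦ hx ?_)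
      rw [hp]
      exact h
  algebraize [f.toRingHom]
  have : IsScalarTower A p.asIdeal.ResidueField K :=
    .of_algebraMap_eq' f.comp_algebraMap.symm
  rw [fiberDegree, ← Module.finrank_baseChange (R := K) (M' := p.asIdeal.Fiber B)]
  exact (Algebra.TensorProduct.cancelBaseChange A p.asIdeal.ResidueField K K B).symm
    |>.toLinearEquiv.finrank_eq

lemma fiberDegree_baseChange (A' : Type*) [CommRing A'] [Algebra A A'] (q : PrimeSpectrum A') :
    fiberDegree A' (A' ⊗[A] B) q = fiberDegree A B (q.comap (algebraMap A A')) := by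
  rw [← finrank_tensorProduct_eq_fiberDegree (K := q.asIdeal.ResidueField)
    (q.comap (algebraMap A A')), fiberDegree]
  · exact (Algebra.TensorProduct.cancelBaseChange A A' q.asIdeal.ResidueField
      q.asIdeal.ResidueField B).toLinearEquiv.finrank_eq
  · rw [IsScalarTower.algebraMap_eq A A' q.asIdeal.ResidueField, ← RingHom.comap_ker,
      Ideal.ker_algebraMap_residueField]
    rfl

lemma fiberDegree_congr {B' : Type*} [CommRing B'] [Algebra A B'] (e : B ≃ₐ[A] B')
    (p : PrimeSpectrum A) : fiberDegree A B p = fiberDegree A B' p :=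
  (Algebra.TensorProduct.congr .refl e : p.asIdeal.Fiber B ≃ₐ[p.asIdeal.ResidueField]
    p.asIdeal.Fiber B').toLinearEquiv.finrank_eq

lemma fiberDegree_self_prod [Algebra.QuasiFinite A B] (p : PrimeSpectrum A) :
    fiberDegree A (A × B) p = fiberDegree A B p + 1 := by
  let e : p.asIdeal.Fiber (A × B) ≃ₐ[p.asIdeal.ResidueField]
      p.asIdeal.ResidueField × p.asIdeal.Fiber B :=
    (Algebra.TensorProduct.prodRight A p.asIdeal.ResidueField p.asIdeal.ResidueField A B).trans
      (.prodCongr (Algebra.TensorProduct.rid A _ _) .refl)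
  rw [fiberDegree, e.toLinearEquiv.finrank_eq, Module.finrank_prod, Module.finrank_self, add_comm,
    fiberDegree]

/-- Over a separably closed field an étale algebra is a finite product of copies of the field, and
its points are the factors. -/
lemma card_algHom_eq_finrank {K : Type*} [Field K] [IsSepClosed K] [Algebra A K]
    [Algebra.Etale A B] :
    Finite (B →ₐ[A] K) ∧ Nat.card (B →ₐ[A] K) = Module.finrank K (K ⊗[A] B) := by
  obtain ⟨n, ⟨e⟩⟩ := Algebra.IsFiniteSplit.nonempty_algEquiv_fun K (K ⊗[A] B)
  have : IsArtinianRing (K ⊗[A] B) := isArtinian_of_tower K inferInstance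
  let e₁ : (B →ₐ[A] K) ≃ PrimeSpectrum (K ⊗[A] B) :=
    (Algebra.TensorProduct.liftEquivRight A K B K).trans
      (Algebra.IsFiniteSplit.algHomEquivPrimeSpectrum K _)
  refine ⟨.of_equiv _ e₁.symm, ?_⟩
  rw [Nat.card_congr e₁, (Algebra.FormallyEtale.equivPiOfIsSepClosed K
    (K ⊗[A] B)).toLinearEquiv.finrank_eq, Module.finrank_eq_nat_card_basis (Pi.basisFun K _)]

end FiberDegree

/-! ### Algebras of tuples of distinct points in the fibres -/

section Configurations

variable {A B : Type u} [CommRing A] [CommRing B] [Algebra A B]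

lemma mem_range_comap_of_fiberDegree_pos {p : PrimeSpectrum A} (h : 0 < fiberDegree A B p) :
    ∃ q : PrimeSpectrum B, q.comap (algebraMap A B) = p :=
  (p.nontrivial_iff_mem_rangeComap).mp (Module.nontrivial_of_finrank_pos h)

/-- There is an étale `A`-algebra `C` parametrizing `k`-tuples of pairwise distinct points
in the fibres of an étale algebra `B`. -/
lemma exists_etale_configuration (k : ℕ) (A B : Type u) [CommRing A] [CommRing B] [Algebra A B]
    [Algebra.Etale A B] :
    ∃ (C : Type u) (_ : CommRing C) (_ : Algebra A C), Algebra.Etale A C ∧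
      (∀ p : PrimeSpectrum A,
        (∃ q : PrimeSpectrum C, q.comap (algebraMap A C) = p) ↔ k ≤ fiberDegree A B p) ∧
      Algebra.adjoin A (⋃ φ : B →ₐ[A] C, Set.range φ) = ⊤ ∧
      ((∀ p, fiberDegree A B p ≤ k) → Nonempty (C ⊗[A] B ≃ₐ[C] (Fin k → C))) := by
  induction k generalizing A B with
  | zero =>
    refine ⟨A, inferInstance, inferInstance, inferInstance, fun p ↦ by simp, ?_, fun h ↦ ?_⟩
    · exact Subsingleton.elim _ _
    · have : Subsingleton B := by
        by_contra hB
        rw [not_subsingleton_iff_nontrivial] at hB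
        obtain ⟨q⟩ : Nonempty (PrimeSpectrum B) := inferInstance
        have : Nontrivial ((q.comap (algebraMap A B)).asIdeal.Fiber B) :=
          (PrimeSpectrum.nontrivial_iff_mem_rangeComap _).mpr ⟨q, rfl⟩
        exact (Module.finrank_pos (R := (q.comap (algebraMap A B)).asIdeal.ResidueField)
          (M := (q.comap (algebraMap A B)).asIdeal.Fiber B)).ne' (Nat.le_zero.mp (h _))
      have : Subsingleton (A ⊗[A] B) := (TensorProduct.lid A B).toEquiv.subsingleton
      exact ⟨default⟩
  | succ k ih =>
    -- The diagonal is a clopen factor of `B ⊗[A] B`; its complement `T` parametrizes pairs of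
    -- distinct points. Over `B`, `T` has fibre degree one less.
    obtain ⟨T, _, _, ⟨e⟩⟩ := Algebra.FormallyUnramified.exists_algEquiv_prod A B
    have : Algebra.Etale B T := by
      algebraize [RingHom.snd B T]
      have : IsScalarTower B (B × T) T := IsScalarTower.of_algebraMap_eq' rfl
      have : Algebra.Etale B (B × T) := .of_equiv e
      exact .comp B (B × T) T
    have hT (q : PrimeSpectrum B) :
        fiberDegree A B (q.comap (algebraMap A B)) = fiberDegree B T q + 1 := by
      rw [← fiberDegree_baseChange, fiberDegree_congr e, fiberDegree_self_prod]
    -- `B` carries the first point of the tuple and the induction hypothesis over `B` the other `k`.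
    obtain ⟨C, _, _, _, hrange, hadj, hsplit⟩ := ih B T
    algebraize [(algebraMap B C).comp (algebraMap A B)]
    refine ⟨C, inferInstance, inferInstance, .comp A B C, fun p ↦ ?_, ?_, fun h ↦ ?_⟩
    · constructor
      · rintro ⟨q, rfl⟩
        have := (hrange _).mp ⟨q, rfl⟩
        rw [IsScalarTower.algebraMap_eq A B C, PrimeSpectrum.comap_comp_apply, hT]
        lia
      · intro h
        obtain ⟨q, rfl⟩ := mem_range_comap_of_fiberDegree_pos (k.succ_pos.trans_le h)
        rw [hT] at h
        obtain ⟨r, rfl⟩ := (hrange q).mpr (by lia)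
        exact ⟨r, by rw [IsScalarTower.algebraMap_eq A B C, PrimeSpectrum.comap_comp_apply]⟩
    · set N := Algebra.adjoin A (⋃ φ : B →ₐ[A] C, Set.range φ) with hN
      have hmem (φ : B →ₐ[A] C) (b : B) : φ b ∈ N :=
        Algebra.subset_adjoin (Set.mem_iUnion.mpr ⟨φ, b, rfl⟩)
      let N' : Subalgebra B C :=
        { N with algebraMap_mem' := fun b ↦ hmem (IsScalarTower.toAlgHom A B C) b }
      have hN' : N' = ⊤ := by
        rw [← top_le_iff, ← hadj]
        refine Algebra.adjoin_le (Set.iUnion_subset fun ψ ↦ ?_)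
        rintro _ ⟨t, rfl⟩
        -- As `T` is a quotient of `B ⊗[A] B`, values of `ψ` are sums of products of values of two
        -- `A`-algebra maps `B → C`.
        let χ : B ⊗[A] B →ₐ[B] C := (ψ.comp (AlgHom.snd B B T)).comp e.toAlgHom
        have hχ (x : B ⊗[A] B) : χ x ∈ N' := by
          induction x with
          | zero => simp
          | add x y hx hy => rw [map_add]; exact add_mem hx hy
          | tmul x y =>
            have : χ (x ⊗ₜ y) = x • (χ.restrictScalars A).comp
                Algebra.TensorProduct.includeRight y := by
              rw [← mul_one x, ← smul_eq_mul, ← TensorProduct.smul_tmul', map_smul]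
              simp
            rw [this]
            exact N'.smul_mem (hmem _ _) _
        simpa [χ] using hχ (e.symm (0, t))
      rw [eq_top_iff]
      intro x _
      have : x ∈ N' := hN' ▸ Algebra.mem_top
      exact this
    · obtain ⟨f⟩ := hsplit fun q ↦ by have := h (q.comap (algebraMap A B)); rw [hT] at this; lia
      let e' : C ⊗[A] B ≃ₐ[C] Unit ⊕ Fin k → C :=
        (Algebra.TensorProduct.cancelBaseChange A B C C B).symm.trans <|
          (Algebra.TensorProduct.congr AlgEquiv.refl e).trans <|
          (Algebra.TensorProduct.prodRight B C C B T).trans <|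
          (AlgEquiv.prodCongr (Algebra.TensorProduct.rid B C C) f).trans <|
          (AlgEquiv.prodCongr (AlgEquiv.funUnique _ _ _).symm AlgEquiv.refl).trans
          (AlgEquiv.sumArrowEquivProdArrow Unit (Fin k) C C).symm
      exact ⟨e'.trans (AlgEquiv.piCongrLeft' _ _ (Fintype.equivOfCardEq (by simp [add_comm])))⟩

end Configurations

/-! ### Integrality over the descended functions -/

section Integrality

variable {A B C : Type*} [CommRing A] [CommRing B] [CommRing C] [Algebra A B] [Algebra A C]

/-- The result depends on `f` only through its target, so the two coprojections `C ⇉ C ⊗[A] C` give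
the same polynomial. -/
lemma charpoly_lmul_one_tmul_map [Module.Free C (C ⊗[A] B)] [Module.Finite C (C ⊗[A] B)]
    {D : Type*} [CommRing D] [Algebra A D] [Module.Free D (D ⊗[A] B)]
    [Module.Finite D (D ⊗[A] B)] (f : C →ₐ[A] D) (b : B) :
    (Algebra.lmul C (C ⊗[A] B) (1 ⊗ₜ b)).charpoly.map f.toRingHom =
      (Algebra.lmul D (D ⊗[A] B) (1 ⊗ₜ b)).charpoly := by
  algebraize [f.toRingHom]
  have : IsScalarTower A C D := .of_algebraMap_eq' f.comp_algebraMap.symm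
  let e := Algebra.TensorProduct.cancelBaseChange A C D D B
  have hconj : e.toLinearEquiv.conj (Algebra.lmul D (D ⊗[C] (C ⊗[A] B)) (1 ⊗ₜ (1 ⊗ₜ b))) =
      Algebra.lmul D (D ⊗[A] B) (1 ⊗ₜ b) := by
    ext x
    simp [LinearEquiv.conj_apply, e]
  rw [← hconj, LinearEquiv.charpoly_conj, ← Algebra.baseChange_lmul (A := D) (1 ⊗ₜ[A] b : C ⊗[A] B)]
  exact (LinearMap.charpoly_baseChange (Algebra.lmul C (C ⊗[A] B) (1 ⊗ₜ b)) D).symm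

/-- If `B` becomes split over `C`, and `C` is generated over `A` by images of `B`, then `C` is
integral over the equalizer of the two coprojections `C ⇉ C ⊗[A] C`. -/
lemma isIntegral_equalizer [Module.Free C (C ⊗[A] B)] [Module.Finite C (C ⊗[A] B)]
    (h : Algebra.adjoin A (⋃ φ : B →ₐ[A] C, Set.range φ) = ⊤) :
    Algebra.IsIntegral (AlgHom.equalizer (Algebra.TensorProduct.includeLeft : C →ₐ[A] C ⊗[A] C)
      Algebra.TensorProduct.includeRight) C := by
  set A' := AlgHom.equalizer (Algebra.TensorProduct.includeLeft : C →ₐ[A] C ⊗[A] C)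
    Algebra.TensorProduct.includeRight
  have hfree : Module.Free (C ⊗[A] C) ((C ⊗[A] C) ⊗[A] B) :=
    .of_equiv (Algebra.TensorProduct.cancelBaseChange A C (C ⊗[A] C) (C ⊗[A] C) B).toLinearEquiv
  have hfin : Module.Finite (C ⊗[A] C) ((C ⊗[A] C) ⊗[A] B) :=
    .equiv (Algebra.TensorProduct.cancelBaseChange A C (C ⊗[A] C) (C ⊗[A] C) B).toLinearEquiv
  have hint (φ : B →ₐ[A] C) (b : B) : IsIntegral A' (φ b) := by
    cases subsingleton_or_nontrivial C
    · rw [Subsingleton.elim (φ b) 0]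
      exact isIntegral_zero
    set P := (Algebra.lmul C (C ⊗[A] B) (1 ⊗ₜ b)).charpoly with hP
    have hmap : P.map (Algebra.TensorProduct.includeLeft : C →ₐ[A] C ⊗[A] C).toRingHom =
        P.map (Algebra.TensorProduct.includeRight : C →ₐ[A] C ⊗[A] C).toRingHom := by
      rw [charpoly_lmul_one_tmul_map, charpoly_lmul_one_tmul_map]
    have hlift : P ∈ Polynomial.lifts (algebraMap A' C) := by
      rw [Polynomial.lifts_iff_coeff_lifts]
      intro n
      refine ⟨⟨P.coeff n, ?_⟩, rfl⟩
      have := congr(($hmap).coeff n)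
      rwa [Polynomial.coeff_map, Polynomial.coeff_map] at this
    obtain ⟨Q, hQ, -, hQm⟩ := Polynomial.lifts_and_degree_eq_and_monic hlift
      (LinearMap.charpoly_monic _)
    refine ⟨Q, hQm, ?_⟩
    -- Cayley–Hamilton kills `1 ⊗ₜ b`; this map carries the relation to `φ b`.
    let ev : C ⊗[A] B →ₐ[C] C :=
      Algebra.TensorProduct.lift (AlgHom.id C C) φ fun _ _ ↦ .all _ _
    have hev : ev (1 ⊗ₜ b) = φ b := by simp [ev]
    rw [← Polynomial.aeval_def, ← Polynomial.aeval_map_algebraMap C, hQ, ← hev,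
      Polynomial.aeval_algHom_apply, Algebra.aeval_self_charpoly_lmul, map_zero]
  have hle : Algebra.adjoin A (⋃ φ : B →ₐ[A] C, Set.range φ) ≤
      (integralClosure A' C).restrictScalars A := by
    refine Algebra.adjoin_le (Set.iUnion_subset fun φ ↦ ?_)
    rintro _ ⟨b, rfl⟩
    exact hint φ b
  exact ⟨fun c ↦ hle (h ▸ Algebra.mem_top)⟩

end Integrality

/-! ### Boundedness of the fibre degree -/

section Bounded

variable {A B : Type u} [CommRing A] [CommRing B] [Algebra A B]

/-- The bound is the number of module generators, hence uniform in `K`. -/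
lemma exists_card_algHom_le (A S : Type*) [CommRing A] [CommRing S] [Algebra A S]
    [Module.Finite A S] :
    ∃ n : ℕ, ∀ (K : Type u) [Field K] [Algebra A K],
      Finite (S →ₐ[A] K) ∧ Nat.card (S →ₐ[A] K) ≤ n := by
  obtain ⟨n, f, hf⟩ := Module.Finite.exists_fin' A S
  refine ⟨n, fun K _ _ ↦ ?_⟩
  let e := Algebra.TensorProduct.liftEquivRight A K S K
  refine ⟨.of_equiv _ e.symm, ?_⟩
  rw [Nat.card_congr e]
  refine (card_algHom_le_finrank K (K ⊗[A] S) K).trans ?_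
  have := LinearMap.finrank_le_finrank_of_surjective (f := f.baseChange K)
    (LinearMap.lTensor_surjective K hf)
  rwa [(TensorProduct.piScalarRight A K K (Fin n)).finrank_eq, Module.finrank_fin_fun] at this

/-- The degrees of the fibres of an étale algebra are bounded. -/
lemma exists_fiberDegree_le (A B : Type u) [CommRing A] [CommRing B] [Algebra A B]
    [Algebra.Etale A B] : ∃ N, ∀ p, fiberDegree A B p ≤ N := by
  -- Zariski's main theorem: near `q`, `B` agrees with a localization of a finite subalgebra.
  have hloc (q : PrimeSpectrum B) : ∃ (S : Subalgebra A B) (r : S), Module.Finite A S ∧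
      r.1 ∉ q.asIdeal ∧ Function.Bijective (Localization.awayMap S.val.toRingHom r) := by
    obtain ⟨S, hS, r, hr, hbij⟩ :=
      Algebra.QuasiFiniteAt.exists_fg_and_exists_notMem_and_awayMap_bijective (R := A) q.asIdeal
    exact ⟨S, r, ⟨(Submodule.fg_top _).mpr hS⟩, hr, hbij⟩
  choose S r hfin hr hbij using hloc
  obtain ⟨t, ht⟩ : ∃ t : Finset (PrimeSpectrum B), ∀ q : PrimeSpectrum B,
      ∃ i ∈ t, (r i).1 ∉ q.asIdeal := by
    obtain ⟨t, ht⟩ := isCompact_univ.elim_finite_subcover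
      (fun q ↦ (PrimeSpectrum.basicOpen (r q).1 : Set (PrimeSpectrum B)))
      (fun q ↦ (PrimeSpectrum.basicOpen _).2) (fun q _ ↦ Set.mem_iUnion.mpr ⟨q, hr q⟩)
    exact ⟨t, fun q ↦ by simpa using ht (Set.mem_univ q)⟩
  choose N hN using fun i ↦ exists_card_algHom_le.{u} A (S i)
  refine ⟨∑ i : t, N i, fun p ↦ ?_⟩
  let K := AlgebraicClosure p.asIdeal.ResidueField
  have hp : p.asIdeal = RingHom.ker (algebraMap A K) := by
    rw [IsScalarTower.algebraMap_eq A p.asIdeal.ResidueField K,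
      RingHom.ker_comp_of_injective _ (algebraMap p.asIdeal.ResidueField K).injective,
      Ideal.ker_algebraMap_residueField]
  rw [← finrank_tensorProduct_eq_fiberDegree (K := K) p hp, ← card_algHom_eq_finrank.2]
  have hφ (φ : B →ₐ[A] K) : ∃ i : t, φ (r i).1 ≠ 0 := by
    obtain ⟨i, hi, h⟩ := ht ⟨RingHom.ker φ, RingHom.ker_isPrime φ⟩
    exact ⟨⟨i, hi⟩, h⟩
  choose idx hidx using hφ
  -- A point not killing `r i` is determined by its restriction to `S i`, since every element of `B`
  -- times a power of `r i` lies in `S i`.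
  let F : (B →ₐ[A] K) → Σ i : t, (S i →ₐ[A] K) := fun φ ↦ ⟨idx φ, φ.comp (S _).val⟩
  have hF : Function.Injective F := by
    intro φ ψ h
    have hi : idx φ = idx ψ := congr(($h).1)
    have hres (s : S (idx φ)) : φ s.1 = ψ s.1 := by
      have key (i : t) (hi : i = idx ψ) (h : (⟨i, φ.comp (S i).val⟩ : Σ i : t, (S i →ₐ[A] K)) =
          ⟨idx ψ, ψ.comp (S (idx ψ)).val⟩) (s : S i) : φ s.1 = ψ s.1 := by
        subst hi
        exact congr($(eq_of_heq (Sigma.mk.inj h).2) s)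
      exact key _ hi h s
    ext b
    obtain ⟨s, m, hs⟩ := Localization.awayMap_surjective_iff.mp (hbij (idx φ)).2 b
    have h₁ := congr(φ $hs)
    have h₂ := congr(ψ $hs)
    simp only [AlgHom.toRingHom_eq_coe, RingHom.coe_coe, Subalgebra.coe_val, map_mul,
      map_pow] at h₁ h₂
    rw [← hres, ← hres] at h₂
    exact mul_left_cancel₀ (pow_ne_zero m (hidx φ)) (h₁.symm.trans h₂)
  have (i : t) : Finite (S i →ₐ[A] K) := (hN i K).1
  refine (Nat.card_le_card_of_injective F hF).trans ?_
  rw [Nat.card_sigma]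
  exact Finset.sum_le_sum fun i _ ↦ (hN i K).2

end Bounded

/-! ### Geometric fibre cardinality as a fibre degree -/

section SchemeDegree

variable {X S : Scheme.{u}}

/-- The degree of the fibre of `f : X ⟶ S` at `s`, for affine `S`. -/
def schemeDegree (f : X ⟶ S) [IsAffine S] (s : S) : ℕ :=
  letI := f.appTop.hom.toAlgebra
  fiberDegree Γ(S, ⊤) Γ(X, ⊤) (S.isoSpec.hom s)

lemma isoSpec_hom_apply_asIdeal [IsAffine S] {K : Type u} [Field K]
    (g : Spec (.of K) ⟶ S) (x : Spec (.of K)) :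
    (S.isoSpec.hom (g x)).asIdeal =
      RingHom.ker (g.appTop ≫ (Scheme.ΓSpecIso (.of K)).hom).hom := by
  have : g ≫ S.isoSpec.hom = Spec.map (g.appTop ≫ (Scheme.ΓSpecIso (.of K)).hom) := by
    simp [Scheme.isoSpec_hom, Scheme.toSpecΓ_naturality]
  rw [← Scheme.Hom.comp_apply, this]
  have hx : x = (⊥ : PrimeSpectrum K) := Subsingleton.elim _ _
  subst hx
  rfl

lemma appTop_specMap_isoSpec_inv [IsAffine X] {R : CommRingCat.{u}} (ψ : Γ(X, ⊤) ⟶ R) :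
    (Spec.map ψ ≫ X.isoSpec.inv).appTop ≫ (Scheme.ΓSpecIso R).hom = ψ := by
  have h : X.isoSpec.inv.appTop = (Scheme.ΓSpecIso Γ(X, ⊤)).inv := by
    rw [← cancel_epi (Scheme.ΓSpecIso Γ(X, ⊤)).hom, Iso.hom_inv_id, ← Scheme.toSpecΓ_appTop,
      ← Scheme.isoSpec_hom, ← Scheme.Hom.comp_appTop, Iso.inv_hom_id, Scheme.Hom.id_appTop]
  rw [Scheme.Hom.comp_appTop, h, Category.assoc, Scheme.ΓSpecIso_naturality, Iso.inv_hom_id_assoc]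

variable [IsAffine X] [IsAffine S] (f : X ⟶ S) [Etale f]

/-- The lifts to `X` of a point of `S` with values in a separably closed field are counted by the
degree of the fibre. -/
lemma card_lifts_eq_schemeDegree {K : Type u} [Field K] [IsSepClosed K]
    (g : Spec (.of K) ⟶ S) (x : Spec (.of K)) :
    ENat.card {t : Spec (.of K) ⟶ X // t ≫ f = g} = schemeDegree f (g x) := by
  let := f.appTop.hom.toAlgebra
  let := (g.appTop ≫ (Scheme.ΓSpecIso (.of K)).hom).hom.toAlgebra
  have : Algebra.Etale Γ(S, ⊤) Γ(X, ⊤) :=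
    RingHom.etale_algebraMap.mp (HasRingHomProperty.appTop @Etale f inferInstance)
  let F : {t : Spec (.of K) ⟶ X // t ≫ f = g} → (Γ(X, ⊤) →ₐ[Γ(S, ⊤)] K) := fun t ↦
    { (t.1.appTop ≫ (Scheme.ΓSpecIso (.of K)).hom).hom with
      commutes' := fun r ↦ by
        obtain ⟨t, rfl⟩ := t
        change _ = ((t ≫ f).appTop ≫ (Scheme.ΓSpecIso (.of K)).hom).hom r
        simp
        rfl }
  have hF : Function.Bijective F := by
    constructor
    · intro t₁ t₂ h
      refine Subtype.ext (ext_of_isAffine ?_)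
      rw [← cancel_mono (Scheme.ΓSpecIso (.of K)).hom]
      ext b
      exact congr($h b)
    · intro φ
      have key := appTop_specMap_isoSpec_inv (X := X) (CommRingCat.ofHom φ.toRingHom)
      refine ⟨⟨Spec.map (CommRingCat.ofHom φ.toRingHom) ≫ X.isoSpec.inv, ext_of_isAffine ?_⟩, ?_⟩
      · rw [← cancel_mono (Scheme.ΓSpecIso (.of K)).hom, Scheme.Hom.comp_appTop, Category.assoc,
          key]
        ext a
        exact φ.commutes a
      · ext b
        exact congr($key b)
  rw [schemeDegree, ← finrank_tensorProduct_eq_fiberDegree (K := K) _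
    (isoSpec_hom_apply_asIdeal g x), ← card_algHom_eq_finrank.2]
  have : Finite (Γ(X, ⊤) →ₐ[Γ(S, ⊤)] K) := card_algHom_eq_finrank.1
  rw [ENat.card_congr (Equiv.ofBijective F hF), ENat.card_eq_coe_natCard]

lemma geomPoint_apply (S : Scheme.{u}) (s : S)
    (x : Spec (.of (AlgebraicClosure (S.residueField s)))) : geomPoint S s x = s := by
  rw [geomPoint, Scheme.Hom.comp_apply, Scheme.fromSpecResidueField_apply]

lemma geomFiberCard_eq_schemeDegree (s : S) : geomFiberCard f s = schemeDegree f s := by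
  have x : Spec (.of (AlgebraicClosure (S.residueField s))) := (⊥ : PrimeSpectrum _)
  rw [geomFiberCard, card_lifts_eq_schemeDegree f _ x, geomPoint_apply]

lemma geomFiberCard_pullback_snd {W : Scheme.{u}} (i : W ⟶ S) (w : W) :
    geomFiberCard (pullback.snd f i) w = geomFiberCard f (i w) := by
  have x : Spec (.of (AlgebraicClosure (W.residueField w))) := (⊥ : PrimeSpectrum _)
  let e : {t : Spec (.of (AlgebraicClosure (W.residueField w))) ⟶ pullback f i //
        t ≫ pullback.snd f i = geomPoint W w} ≃
      {t : Spec (.of (AlgebraicClosure (W.residueField w))) ⟶ X //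
        t ≫ f = geomPoint W w ≫ i} :=
    { toFun t := ⟨t.1 ≫ pullback.fst f i, by
        rw [Category.assoc, pullback.condition, reassoc_of% t.2]⟩
      invFun t := ⟨pullback.lift t.1 (geomPoint W w) t.2, pullback.lift_snd _ _ _⟩
      left_inv t := by
        exact Subtype.ext (pullback.hom_ext (pullback.lift_fst _ _ _)
          ((pullback.lift_snd _ _ _).trans t.2.symm))
      right_inv t := Subtype.ext (pullback.lift_fst _ _ _) }
  rw [geomFiberCard, ENat.card_congr e, card_lifts_eq_schemeDegree f _ x, Scheme.Hom.comp_apply,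
    geomPoint_apply, geomFiberCard_eq_schemeDegree]

lemma exists_schemeDegree_le : ∃ N, ∀ s, schemeDegree f s ≤ N := by
  let := f.appTop.hom.toAlgebra
  have : Algebra.Etale Γ(S, ⊤) Γ(X, ⊤) :=
    RingHom.etale_algebraMap.mp (HasRingHomProperty.appTop @Etale f inferInstance)
  obtain ⟨N, hN⟩ := exists_fiberDegree_le Γ(S, ⊤) Γ(X, ⊤)
  exact ⟨N, fun s ↦ hN _⟩

end SchemeDegree

/-! ### Descending integrality to the image of a configuration algebra -/

section Descent

/-- The morphism to an affine scheme `S` given by an algebra over the global sections of `S`. -/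
def specToAffine (S : Scheme.{u}) [IsAffine S] (C : Type u) [CommRing C] [Algebra Γ(S, ⊤) C] :
    Spec (.of C) ⟶ S :=
  Spec.map (CommRingCat.ofHom (algebraMap Γ(S, ⊤) C)) ≫ S.isoSpec.inv

variable {S : Scheme.{u}} [IsAffine S] {C : Type u} [CommRing C] [Algebra Γ(S, ⊤) C]

instance [Algebra.Etale Γ(S, ⊤) C] : Etale (specToAffine S C) := by
  have : Etale (Spec.map (CommRingCat.ofHom (algebraMap Γ(S, ⊤) C))) :=
    (HasRingHomProperty.Spec_iff (P := @Etale)).mpr (RingHom.etale_algebraMap.mpr ‹_›)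
  rw [specToAffine]
  infer_instance

lemma mem_range_specToAffine (s : S) : s ∈ Set.range (specToAffine S C) ↔
    ∃ q : PrimeSpectrum C, q.comap (algebraMap Γ(S, ⊤) C) = S.isoSpec.hom s := by
  refine exists_congr fun q ↦ ?_
  rw [← S.isoSpec.hom.homeomorph.injective.eq_iff]
  change S.isoSpec.hom (specToAffine S C q) = S.isoSpec.hom s ↔ _
  rw [specToAffine, ← Scheme.Hom.comp_apply, Category.assoc, Iso.inv_hom_id, Category.comp_id]
  rfl

lemma isPullback_specToAffine {X : Scheme.{u}} [IsAffine X] (f : X ⟶ S) [Algebra Γ(S, ⊤) Γ(X, ⊤)]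
    (h : algebraMap Γ(S, ⊤) Γ(X, ⊤) = f.appTop.hom) :
    IsPullback (Spec.map (CommRingCat.ofHom (Algebra.TensorProduct.includeLeftRingHom :
        C →+* C ⊗[Γ(S, ⊤)] Γ(X, ⊤))))
      (Spec.map (CommRingCat.ofHom (Algebra.TensorProduct.includeRight :
        Γ(X, ⊤) →ₐ[Γ(S, ⊤)] C ⊗[Γ(S, ⊤)] Γ(X, ⊤)).toRingHom) ≫ X.isoSpec.inv)
      (specToAffine S C) f := by
  refine (isPullback_SpecMap_of_isPushout _ _ _ _
    (CommRingCat.isPushout_tensorProduct Γ(S, ⊤) C Γ(X, ⊤))).paste_vert ?_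
  refine IsPullback.of_vert_isIso ⟨?_⟩
  rw [h]
  exact Scheme.isoSpec_inv_naturality f

lemma isIntegral_appTop_of_isIntegral_equalizer {U : Scheme.{u}} (q : Spec (.of C) ⟶ U)
    [EffectiveEpi q] (i : U ⟶ S) (hq : q ≫ i = specToAffine S C)
    (h : Algebra.IsIntegral (AlgHom.equalizer
      (Algebra.TensorProduct.includeLeft : C →ₐ[Γ(S, ⊤)] C ⊗[Γ(S, ⊤)] C)
      Algebra.TensorProduct.includeRight) C) : q.appTop.hom.IsIntegral := by
  let R := AlgHom.equalizer
      (Algebra.TensorProduct.includeLeft : C →ₐ[Γ(S, ⊤)] C ⊗[Γ(S, ⊤)] C)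
      Algebra.TensorProduct.includeRight
  let ρ : Spec (.of C) ⟶ Spec (.of R) := Spec.map (CommRingCat.ofHom (algebraMap R C))
  have hρ : IsIntegralHom ρ := IsIntegralHom.SpecMap_iff.mpr (algebraMap_isIntegral_iff.mpr h)
  -- Such a pair factors through `Spec (C ⊗[A] C)` with `A = Γ(S, ⊤)`, where the two pullbacks of
  -- elements of `R` agree. So `ρ` factors through `q`.
  have hdesc {Z : Scheme.{u}} (g₁ g₂ : Z ⟶ Spec (.of C)) (hg : g₁ ≫ q = g₂ ≫ q) :
      g₁ ≫ ρ = g₂ ≫ ρ := by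
    have hg' : g₁ ≫ Spec.map (CommRingCat.ofHom (algebraMap Γ(S, ⊤) C)) =
        g₂ ≫ Spec.map (CommRingCat.ofHom (algebraMap Γ(S, ⊤) C)) := by
      rw [← cancel_mono S.isoSpec.inv, Category.assoc, Category.assoc, ← specToAffine, ← hq,
        reassoc_of% hg]
    have hP := isPullback_SpecMap_of_isPushout _ _ _ _
      (CommRingCat.isPushout_tensorProduct Γ(S, ⊤) C C)
    obtain ⟨l, rfl, rfl⟩ := hP.exists_lift _ _ hg'
    rw [Category.assoc, Category.assoc,
      ← Spec.map_comp, ← Spec.map_comp]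
    congr 2
    ext r
    exact r.2
  have hfac := EffectiveEpi.fac q ρ hdesc
  have := ρ.isIntegral_app ⊤ (isAffineOpen_top _)
  change ρ.appTop.hom.IsIntegral at this
  rw [← hfac, Scheme.Hom.comp_appTop] at this
  exact RingHom.IsIntegral.tower_top _ _ this

end Descent

/-! ### Affineness and finiteness over the locus of maximal degree -/

section Affine

/-- A quasi-affine scheme admitting a surjection from an affine scheme that is integral on global
sections is affine. -/
lemma isAffine_of_isIntegral_appTop {Y U : Scheme.{u}} [IsAffine Y] [U.IsQuasiAffine] (q : Y ⟶ U)
    [Surjective q] (hint : q.appTop.hom.IsIntegral) : IsAffine U := by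
  have hker : RingHom.ker q.appTop.hom ≤ nilradical Γ(U, ⊤) := by
    intro x hx
    rw [mem_nilradical, Scheme.isNilpotent_iff_basicOpen_eq_bot]
    have h : q ⁻¹ᵁ U.basicOpen x = ⊥ := by
      rw [Scheme.preimage_basicOpen_top]
      erw [hx]
      exact Scheme.basicOpen_zero _ _
    ext u
    obtain ⟨y, rfl⟩ := q.surjective u
    exact congr(y ∈ $h).to_iff
  -- The image is closed by integrality and dense because the kernel is nil.
  have hsurj : Function.Surjective (Spec.map q.appTop) := by
    have h : IsClosed (Set.range (PrimeSpectrum.comap q.appTop.hom)) :=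
      (PrimeSpectrum.isClosedMap_comap_of_isIntegral _ hint).isClosed_range
    exact Set.range_eq_univ.mp (h.closure_eq ▸
      (PrimeSpectrum.denseRange_comap_iff_ker_le_nilRadical _ |>.mpr hker).closure_range)
  have : Surjective U.toSpecΓ := by
    refine ⟨fun p ↦ ?_⟩
    obtain ⟨y, rfl⟩ := hsurj p
    refine ⟨q (Y.isoSpec.inv y), ?_⟩
    rw [← Scheme.Hom.comp_apply, ← Scheme.Hom.comp_apply]
    congr 2
    simp [Scheme.toSpecΓ_naturality, ← Scheme.isoSpec_hom]
  have : IsIso U.toSpecΓ := (isIso_iff_isOpenImmersion_and_surjective _).mpr ⟨inferInstance, this⟩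
  exact .of_isIso U.toSpecΓ

/-- An affine morphism is integral exactly when it is universally closed, and the latter descends.
-/
lemma isFinite_of_isFinite_pullback {P X Y Z : Scheme.{u}} {fst : P ⟶ X} {snd : P ⟶ Y} {f : X ⟶ Z}
    {g : Y ⟶ Z} (h : IsPullback fst snd f g) [Surjective f] [Flat f] [QuasiCompact f]
    [IsAffineHom g] [LocallyOfFiniteType g] [IsFinite fst] : IsFinite g := by
  rw [IsFinite.iff_isIntegralHom_and_locallyOfFiniteType,
    IsIntegralHom.iff_universallyClosed_and_isAffineHom]
  exact ⟨⟨MorphismProperty.of_isPullback_of_descendsAlong (P := @UniversallyClosed)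
    (Q := @Surjective ⊓ @Flat ⊓ @QuasiCompact) h ⟨⟨‹_›, ‹_›⟩, ‹_›⟩ inferInstance, inferInstance⟩,
    inferInstance⟩

/-- The locus where the fibre degree is at least `k` is open. -/
lemma isOpen_le_schemeDegree {X S : Scheme.{u}} [IsAffine X] [IsAffine S] (f : X ⟶ S) [Etale f]
    (k : ℕ) : IsOpen {s | k ≤ schemeDegree f s} := by
  let := f.appTop.hom.toAlgebra
  have : Algebra.Etale Γ(S, ⊤) Γ(X, ⊤) :=
    RingHom.etale_algebraMap.mp (HasRingHomProperty.appTop @Etale f inferInstance)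
  obtain ⟨C, _, _, _, hrange, -, -⟩ := exists_etale_configuration k Γ(S, ⊤) Γ(X, ⊤)
  convert (specToAffine S C).isOpenMap.isOpen_range
  ext s
  exact ((mem_range_specToAffine s).trans (hrange _)).symm

/-- The locus where the fibre degree takes its maximal value `m` is an affine open, over which
`f` is finite. -/
lemma exists_affine_open_schemeDegree_eq {X S : Scheme.{u}} [IsAffine X] [IsAffine S] (f : X ⟶ S)
    [Etale f] (m : ℕ) (hm : ∀ s, schemeDegree f s ≤ m) :
    ∃ U : S.Opens, (U : Set S) = {s | schemeDegree f s = m} ∧ IsAffine U ∧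
      IsFinite (f ∣_ U) := by
  let := f.appTop.hom.toAlgebra
  have : Algebra.Etale Γ(S, ⊤) Γ(X, ⊤) :=
    RingHom.etale_algebraMap.mp (HasRingHomProperty.appTop @Etale f inferInstance)
  obtain ⟨C, _, _, _, hrange, hadj, hsplit⟩ := exists_etale_configuration m Γ(S, ⊤) Γ(X, ⊤)
  obtain ⟨e⟩ := hsplit fun p ↦ by
    obtain ⟨s, rfl⟩ := S.isoSpec.hom.homeomorph.surjective p
    exact hm s
  let U : S.Opens := ⟨Set.range (specToAffine S C),
    (specToAffine S C).isOpenMap.isOpen_range⟩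
  let q : Spec (.of C) ⟶ U := IsOpenImmersion.lift U.ι (specToAffine S C) (by simp [U])
  have hq : q ≫ U.ι = specToAffine S C := IsOpenImmersion.lift_fac _ _ _
  have : IsAffineHom (q ≫ U.ι) := hq ▸ inferInstance
  have : Etale (q ≫ U.ι) := hq ▸ inferInstance
  have : IsAffineHom q := .of_comp q U.ι
  have : Etale q := .of_comp q U.ι
  have : Surjective q := by
    refine ⟨fun u ↦ ?_⟩
    obtain ⟨y, hy⟩ := u.2
    refine ⟨y, U.ι.injective ?_⟩
    rw [← Scheme.Hom.comp_apply, hq]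
    exact hy
  have : CompactSpace U := q.surjective.compactSpace q.continuous
  have : U.toScheme.IsQuasiAffine := .of_isImmersion U.ι
  have := Module.Free.of_equiv e.symm.toLinearEquiv
  have := Module.Finite.equiv e.symm.toLinearEquiv
  refine ⟨U, ?_, isAffine_of_isIntegral_appTop q
    (isIntegral_appTop_of_isIntegral_equalizer q U.ι hq (isIntegral_equalizer hadj)), ?_⟩
  · ext s
    refine ((mem_range_specToAffine s).trans (hrange _)).trans ?_
    exact ⟨fun h ↦ (hm s).antisymm h, fun h ↦ h.ge⟩
  · have h₁ := isPullback_specToAffine (C := C) f rfl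
    rw [← hq] at h₁
    have : IsFinite (Spec.map (CommRingCat.ofHom (Algebra.TensorProduct.includeLeftRingHom :
        C →+* C ⊗[Γ(S, ⊤)] Γ(X, ⊤)))) :=
      (IsFinite.SpecMap_iff _).mpr (RingHom.finite_algebraMap.mpr ‹_›)
    have : IsAffineHom (f ∣_ U) := MorphismProperty.of_isPullback (P := @IsAffineHom)
      (isPullback_morphismRestrict f U).flip inferInstance
    exact isFinite_of_isFinite_pullback
      (IsPullback.of_right' h₁.flip (isPullback_morphismRestrict f U).flip).flip

end Affine

/-! ### Existence, description and purity of the strata -/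

section Stratification

variable {S : Scheme.{u}}

lemma range_reducedClosedι (Z : Closeds S) : Set.range (reducedClosedι Z) = Z := by
  simp [Scheme.IdealSheafData.range_subschemeι]

instance (Z : Closeds S) : AlgebraicGeometry.IsReduced (reducedClosed Z) := by
  let I := Scheme.IdealSheafData.vanishingIdeal Z
  have (i : S.affineOpens) : AlgebraicGeometry.IsReduced (Spec (.of (Γ(S, i.1) ⧸ I.ideal i))) := by
    have : _root_.IsReduced (Γ(S, i.1) ⧸ I.ideal i) := by
      rw [← Ideal.isRadical_iff_quotient_reduced, Scheme.IdealSheafData.vanishingIdeal_ideal]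
      exact PrimeSpectrum.isRadical_vanishingIdeal _
    infer_instance
  have : ∀ i, AlgebraicGeometry.IsReduced (I.subschemeCover.openCover.X i) := this
  exact .of_openCover _ I.subschemeCover.openCover

instance [IsAffine S] (Z : Closeds S) : IsAffine (reducedClosed Z) :=
  isAffine_of_isAffineHom (reducedClosedι Z)

lemma range_stratumι {Z : Closeds S} (W : (reducedClosed Z).Opens) :
    Set.range (stratumι W) = reducedClosedι Z '' W := by
  rw [Scheme.Hom.comp_base, TopCat.coe_comp, Set.range_comp]
  congr 1
  exact W.range_ι

lemma isFinite_pullback_snd_stratumι {X : Scheme.{u}} (f : X ⟶ S) {Z : Closeds S}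
    (W : (reducedClosed Z).Opens) [IsFinite (pullback.snd f (reducedClosedι Z) ∣_ W)] :
    IsFinite (pullback.snd f (stratumι W)) := by
  rw [← pullbackLeftPullbackSndIso_inv_snd_snd,
    ← pullbackRestrictIsoRestrict_hom_morphismRestrict]
  infer_instance

variable {X : Scheme.{u}} [IsAffine X] [IsAffine S] (f : X ⟶ S) [Etale f]

/-- If `m` bounds the fibre degrees along the closed subset `Z`, then the locus in `Z` where the
fibre degree is `m` underlies an affine open subscheme of `Z`, the greatest one over which `f` is an
étale cover of degree `m`. -/
lemma exists_isGreatest_isEtaleCoverOfCard (Z : Closeds S) (m : ℕ)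
    (hZ : ∀ s ∈ Z, schemeDegree f s ≤ m) :
    ∃ W : (reducedClosed Z).Opens,
      IsGreatest {W | IsEtaleCoverOfCard (pullback.snd f (stratumι W)) m} W ∧
      Set.range (stratumι W) = {s | s ∈ Z ∧ schemeDegree f s = m} ∧ IsAffine W := by
  have hmem (z : reducedClosed Z) : reducedClosedι Z z ∈ Z := by
    rw [← SetLike.mem_coe, ← range_reducedClosedι]
    exact Set.mem_range_self z
  have hdeg (z : reducedClosed Z) : schemeDegree (pullback.snd f (reducedClosedι Z)) z =
      schemeDegree f (reducedClosedι Z z) := by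
    rw [← ENat.natCast_inj, ← geomFiberCard_eq_schemeDegree, geomFiberCard_pullback_snd,
      geomFiberCard_eq_schemeDegree]
  have hcard {W : (reducedClosed Z).Opens} (w : W.toScheme) :
      geomFiberCard (pullback.snd f (stratumι W)) w =
        schemeDegree (pullback.snd f (reducedClosedι Z)) (W.ι w) := by
    rw [geomFiberCard_pullback_snd, geomFiberCard_eq_schemeDegree, hdeg,
      ← Scheme.Hom.comp_apply]
  obtain ⟨W, hW, haff, hfin⟩ := exists_affine_open_schemeDegree_eq
    (pullback.snd f (reducedClosedι Z)) m fun z ↦ (hdeg z).trans_le (hZ _ (hmem z))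
  refine ⟨W, ⟨⟨isFinite_pullback_snd_stratumι f W, inferInstance, fun w ↦ ?_⟩, ?_⟩, ?_, haff⟩
  · rw [hcard]
    exact congrArg _ (hW.le w.2)
  -- Maximality is pointwise: every point of a competitor already has degree `m`.
  · intro W' hW' w hw
    refine hW.ge ?_
    exact ENat.natCast_inj.mp ((hcard ⟨w, hw⟩).symm.trans (hW'.card_eq ⟨w, hw⟩))
  · rw [range_stratumι, hW]
    ext s
    constructor
    · rintro ⟨z, hz, rfl⟩
      exact ⟨hmem z, (hdeg z).symm.trans hz⟩
    · rintro ⟨hs, hs'⟩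
      obtain ⟨z, rfl⟩ := (range_reducedClosedι Z).ge hs
      exact ⟨z, (hdeg z).trans hs', rfl⟩

theorem nonempty_functorialStratification : Nonempty (FunctorialStratification f) := by
  obtain ⟨N, hN⟩ := exists_schemeDegree_le f
  have hfin : (Set.range (schemeDegree f)).Finite :=
    (Set.finite_Iic N).subset (by rintro _ ⟨s, rfl⟩; exact hN s)
  let T := hfin.toFinset
  -- `orderEmbOfFin` lists the values increasingly; `rev` makes the sequence decreasing.
  let μ : Fin T.card → ℕ := fun l ↦ T.orderEmbOfFin rfl l.rev
  have hμ : StrictAnti μ := fun i j h ↦ (T.orderEmbOfFin rfl).strictMono (Fin.rev_lt_rev.mpr h)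
  have hrange : Set.range μ = Set.range (schemeDegree f) := by
    have : μ = T.orderEmbOfFin rfl ∘ Fin.rev := rfl
    rw [this, Fin.rev_surjective.range_comp, Finset.range_orderEmbOfFin, hfin.coe_toFinset]
  let Z (l : Fin T.card) : Closeds S := ⟨{s | schemeDegree f s ≤ μ l}, by
    rw [← isOpen_compl_iff]
    convert isOpen_le_schemeDegree f (μ l + 1)
    ext s
    simp⟩
  choose U hU hUrange _ using fun l ↦ exists_isGreatest_isEtaleCoverOfCard f (Z l) (μ l)
    fun s hs ↦ hs
  refine ⟨⟨_, μ, hμ, ?_, Z, U, fun l ↦ ?_, hU⟩⟩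
  · rw [show geomFiberCard f = (↑) ∘ schemeDegree f from
      funext fun s ↦ geomFiberCard_eq_schemeDegree f s, Set.range_comp, ← hrange, ← Set.range_comp]
    rfl
  · ext s
    simp only [hUrange, Set.mem_compl_iff, Set.mem_iUnion, not_exists]
    constructor
    · intro (hs : schemeDegree f s ≤ μ l) q hq
      exact (hq.2.symm.trans_le hs).not_gt (hμ q.2)
    · intro h
      obtain ⟨q, hq⟩ := hrange.ge (Set.mem_range_self s)
      by_contra hs
      exact h ⟨q, hμ.lt_iff_gt.mp ((not_le.mp hs).trans_eq hq.symm)⟩ ⟨hq.ge, hq.symm⟩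

variable {f}

theorem FunctorialStratification.range_stratumι_and_isAffine (σ : FunctorialStratification f)
    (l : Fin σ.v) : Set.range (stratumι (σ.U l)) = {s | geomFiberCard f s = σ.μ l} ∧
      IsAffine (σ.U l) := by
  -- Knowing the earlier strata identifies `σ.Z l` as the locus avoiding the earlier, larger values,
  -- so `σ.μ l` bounds the degree there.
  induction l using WellFoundedLT.induction with
  | ind l ih =>
  have hvalue (s : S) : ∃ q, schemeDegree f s = σ.μ q := by
    obtain ⟨q, hq⟩ := σ.range_eq.ge (Set.mem_range_self s)
    rw [geomFiberCard_eq_schemeDegree, ENat.natCast_inj] at hq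
    exact ⟨q, hq.symm⟩
  have hZ (s : S) : s ∈ σ.Z l ↔ ∀ q < l, schemeDegree f s ≠ σ.μ q := by
    rw [← SetLike.mem_coe, σ.Z_eq]
    simp only [Set.mem_compl_iff, Set.mem_iUnion, Subtype.exists, not_exists]
    refine forall₂_congr fun q hq ↦ ?_
    rw [(ih q hq).1, Set.mem_ofPred_eq, geomFiberCard_eq_schemeDegree, ENat.natCast_inj]
  obtain ⟨W, hW, hrange, haff⟩ := exists_isGreatest_isEtaleCoverOfCard f (σ.Z l) (σ.μ l) <| by
    intro s hs
    obtain ⟨q, hq⟩ := hvalue s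
    rw [hq]
    exact σ.strictAnti.antitone (not_lt.mp fun h ↦ (hZ s).mp hs q h hq)
  rw [(σ.isGreatest l).unique hW]
  refine ⟨hrange.trans ?_, haff⟩
  ext s
  rw [Set.mem_ofPred_eq, Set.mem_ofPred_eq, geomFiberCard_eq_schemeDegree, ENat.natCast_inj,
    and_iff_right_iff_imp, hZ]
  exact fun h q hq h' ↦ hq.ne (σ.strictAnti.injective (h'.symm.trans h))

theorem isPure_stratumι {Z : Closeds S} (W : (reducedClosed Z).Opens) [IsAffine W] :
    IsPure (stratumι W) :=
  ⟨inferInstance, inferInstance, inferInstance⟩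

end Stratification

end ASStrat

end

theorem theoremT2 (p : ℕ) [Fact p.Prime] (A B : Type u) [CommRing A] [CommRing B]
    [Algebra (ZMod p) A] (ε : Spec (CommRingCat.of B) ⟶ Spec (CommRingCat.of A)) [Etale ε] :
    Nonempty (ASStrat.FunctorialStratification ε) ∧
    ∀ σ : ASStrat.FunctorialStratification ε, ∀ l : Fin σ.v,
      Set.range (ASStrat.stratumι (σ.U l)) =
        {x | ASStrat.geomFiberCard ε x = (σ.μ l : ℕ∞)} ∧
      ASStrat.IsPure (ASStrat.stratumι (σ.U l)) := by
  refine ⟨ASStrat.nonempty_functorialStratification ε, fun σ l ↦ ?_⟩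
  obtain ⟨hrange, _⟩ := σ.range_stratumι_and_isAffine l
  exact ⟨hrange, ASStrat.isPure_stratumι _⟩
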